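/- An algebraic circuit over $\mathbb{C}$ is a finite directed acyclic graph whose nodes are leaves labelled by variables or by constants, product nodes, and sum nodes (of arbitrary fan-in; wires into sum nodes carry constants, so that sum nodes compute linear combinations of their children), with one node designated as the root; the circuit computes the polynomial computed at its root. Its size is the number of its nodes plus the number of its wires, and $S(f)$ denotes the least size of an algebraic circuit computing $f$. For $1\le i\le n$ let $e_i$, $h_i$ and $p_i$ be the elementary, complete homogeneous and power-sum symmetric polynomials of degree $i$ in $x_1,\dots,x_n$. **Theorem.** There are absolute constants $K,c\in\mathbb{N}$ such that for every $n\ge 0$ and every symmetric polynomial $f_{sym}\in\mathbb{C}[x_1,\dots,x_n]$ there are unique polynomials $f_E,f_H,f_P\in\mathbb{C}[x_1,\dots,x_n]$ with $$f_{sym}=f_E(e_1,\dots,e_n)=f_H(h_1,\dots,h_n)=f_P(p_1,\dots,p_n),$$ and, with $d=\deg f_E$ the total degree of $f_E$ (where $\deg 0=0$), each of $S(f_E)$, $S(f_H)$, $S(f_P)$ is at most $$K\,d^2\,S(f_{sym})+c\,(n+d+1)^c .$$ -/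

import Mathlib

/-- A node of an algebraic circuit with variables `σ` and constants `k`, whose children are among
`m` earlier nodes. Fan-in is unbounded. The wires entering a `sum` node carry constants,
so that it computes a linear combination of its children. The lists allow parallel wires.
(A `sum` or `prod` node without children is worth `0` or `1`, the same as a constant leaf
of the same size.) -/
inductive AlgGate (k σ : Type*) (m : ℕ) where
  | var (i : σ) : AlgGate k σ m
  | const (c : k) : AlgGate k σ m
  | sum (l : List (k × Fin m)) : AlgGate k σ m
  | prod (l : List (Fin m)) : AlgGate k σ m

/-- An algebraic circuit with `m` nodes: a directed acyclic graph, given with a topological order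
of its nodes. The node appended last has its children among the previous ones. -/
inductive AlgCircuit (k σ : Type*) : ℕ → Type _ where
  | nil : AlgCircuit k σ 0
  | snoc {m : ℕ} (C : AlgCircuit k σ m) (g : AlgGate k σ m) : AlgCircuit k σ (m + 1)

/-- The number of wires entering a node. -/
def AlgGate.fanIn {k σ : Type*} {m : ℕ} : AlgGate k σ m → ℕ
  | .var _ => 0
  | .const _ => 0
  | .sum l => l.length
  | .prod l => l.length

/-- The polynomial computed at a node from the polynomials computed at the earlier nodes. -/
noncomputable def AlgGate.eval {k σ : Type*} [CommSemiring k] {m : ℕ}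
    (v : Fin m → MvPolynomial σ k) : AlgGate k σ m → MvPolynomial σ k
  | .var i => MvPolynomial.X i
  | .const c => MvPolynomial.C c
  | .sum l => (l.map fun a => MvPolynomial.C a.1 * v a.2).sum
  | .prod l => (l.map v).prod

/-- The size of a circuit: the number of its nodes plus the number of its wires. -/
def AlgCircuit.size {k σ : Type*} : {m : ℕ} → AlgCircuit k σ m → ℕ
  | _, .nil => 0
  | _, .snoc C g => C.size + (1 + g.fanIn)

/-- The polynomial computed at each node of a circuit. -/
noncomputable def AlgCircuit.value {k σ : Type*} [CommSemiring k] :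
    {m : ℕ} → AlgCircuit k σ m → Fin m → MvPolynomial σ k
  | _, .nil => Fin.elim0
  | _, .snoc C g => Fin.snoc (α := fun _ => MvPolynomial σ k) C.value (g.eval C.value)

/-- `HasCircuitOfSize f s`: some algebraic circuit of size `s` computes `f` at one of its nodes,
its root. (Nodes from which the root cannot be reached are not forbidden; removing them makes
the root the unique sink and only decreases the size.) -/
def HasCircuitOfSize {k σ : Type*} [CommSemiring k] (f : MvPolynomial σ k) (s : ℕ) : Prop :=
  ∃ (m : ℕ) (C : AlgCircuit k σ m) (r : Fin m), C.value r = f ∧ C.size = s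

/-- Every circuit can be extended to one that also computes a given polynomial. -/
theorem AlgCircuit.exists_extension {k σ : Type*} [CommSemiring k] (f : MvPolynomial σ k) :
    ∀ (m : ℕ) (C : AlgCircuit k σ m), ∃ (m' : ℕ) (D : AlgCircuit k σ m') (e : Fin m → Fin m'),
      (∀ i, D.value (e i) = C.value i) ∧ ∃ r, D.value r = f := by
  induction f using MvPolynomial.induction_on with
  | C a =>
    intro m C
    refine ⟨m + 1, C.snoc (.const a), Fin.castSucc, ?_, Fin.last m, ?_⟩ <;>
      simp [AlgCircuit.value, AlgGate.eval]
  | add p q hp hq =>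
    intro m C
    obtain ⟨m₁, D₁, e₁, h₁, r₁, hr₁⟩ := hp m C
    obtain ⟨m₂, D₂, e₂, h₂, r₂, hr₂⟩ := hq m₁ D₁
    refine ⟨m₂ + 1, D₂.snoc (.sum [(1, e₂ r₁), (1, r₂)]), fun i => (e₂ (e₁ i)).castSucc, ?_,
      Fin.last m₂, ?_⟩ <;> simp [AlgCircuit.value, AlgGate.eval, h₁, h₂, hr₁, hr₂]
  | mul_X p i hp =>
    intro m C
    obtain ⟨m₁, D₁, e₁, h₁, r₁, hr₁⟩ := hp m C
    refine ⟨m₁ + 1 + 1, (D₁.snoc (.var i)).snoc (.prod [r₁.castSucc, Fin.last m₁]),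
      fun i => (e₁ i).castSucc.castSucc, ?_, Fin.last _, ?_⟩ <;>
      simp [AlgCircuit.value, AlgGate.eval, h₁, hr₁]

/-- Every polynomial is computed by some circuit. -/
theorem exists_hasCircuitOfSize {k σ : Type*} [CommSemiring k] (f : MvPolynomial σ k) :
    ∃ s, HasCircuitOfSize f s := by
  obtain ⟨m, D, _, _, r, hr⟩ := AlgCircuit.exists_extension f 0 .nil
  exact ⟨D.size, m, D, r, hr, rfl⟩

open Classical in
/-- The circuit complexity `S(f)`: the least size of an algebraic circuit computing `f`. -/
noncomputable def circuitSize {k σ : Type*} [CommSemiring k] (f : MvPolynomial σ k) : ℕ :=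
  Nat.find (exists_hasCircuitOfSize f)

/-!
Write `f = p (e₁, …, eₙ)` with `deg p = d`. To compute `p w` from a circuit for `f`, evaluate `f`
at points whose elementary symmetric functions are `w`, that is, at the roots of the monic
polynomial with coefficients `± w j`. Such roots exist as power series in `t` along the line
`e(a) + t (w - e(a))` which starts at `t = 0` from a tuple `a` of distinct integers: there the roots
are simple, so Newton's iteration gives them modulo `t ^ (d + 1)` by a small circuit. Since
`p (e(a) + t (w - e(a)))` has degree at most `d` in `t`, its coefficients are those of `f` at the
truncated roots, and their sum is the value `p w` at `t = 1`. Computing with polynomials in `t`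
truncated at degree `d` multiplies the size by `O((d + 1) ^ 2)`.

Take `w = x` for `f_E`. The `eᵢ` satisfy recursions in terms of the `hᵢ` and in terms of the `pᵢ`,
so small circuits express them through either family; these are the `w` for `f_H` and `f_P`.
-/

section CircuitExtension

variable {k σ : Type*} [CommSemiring k] {S S' T T' U : Set (MvPolynomial σ k)} {c c' : ℕ}

/-- `Derives S T c`: every circuit computing the polynomials in `S` can be extended, at the cost
of `c` additional nodes and wires, to a circuit that also computes the polynomials in `T`. -/
def Derives (S T : Set (MvPolynomial σ k)) (c : ℕ) : Prop :=
  ∀ (m : ℕ) (C : AlgCircuit k σ m), S ⊆ Set.range C.value →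
    ∃ (m' : ℕ) (D : AlgCircuit k σ m'), Set.range C.value ⊆ Set.range D.value ∧
      T ⊆ Set.range D.value ∧ D.size ≤ C.size + c

namespace Derives

theorem mono_source (h : Derives S T c) (hS : S ⊆ S') : Derives S' T c :=
  fun m C hC => h m C (hS.trans hC)

theorem mono_target (h : Derives S T c) (hT : T' ⊆ T) : Derives S T' c := by
  intro m C hC
  obtain ⟨m', D, hCD, hTD, hsize⟩ := h m C hC
  exact ⟨m', D, hCD, hT.trans hTD, hsize⟩

theorem mono_cost (h : Derives S T c) (hc : c ≤ c') : Derives S T c' := by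
  intro m C hC
  obtain ⟨m', D, hCD, hTD, hsize⟩ := h m C hC
  exact ⟨m', D, hCD, hTD, hsize.trans (by lia)⟩

theorem of_subset (h : T ⊆ S) (c : ℕ) : Derives S T c :=
  fun m C hC => ⟨m, C, subset_rfl, h.trans hC, by lia⟩

theorem trans_union (h : Derives S T c) (h' : Derives (S ∪ T) U c') :
    Derives S (T ∪ U) (c + c') := by
  intro m C hC
  obtain ⟨m₁, D₁, hCD₁, hTD₁, hsize₁⟩ := h m C hC
  obtain ⟨m₂, D₂, hD, hUD₂, hsize₂⟩ := h' m₁ D₁ (Set.union_subset (hC.trans hCD₁) hTD₁)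
  exact ⟨m₂, D₂, hCD₁.trans hD, Set.union_subset (hTD₁.trans hD) hUD₂, by lia⟩

theorem trans_of_union (h : Derives S T c) (h' : Derives (S ∪ T) U c') : Derives S U (c + c') :=
  (h.trans_union h').mono_target Set.subset_union_right

theorem trans (h : Derives S T c) (h' : Derives T U c') : Derives S U (c + c') :=
  h.trans_of_union (h'.mono_source Set.subset_union_right)

theorem union (h : Derives S T c) (h' : Derives S U c') : Derives S (T ∪ U) (c + c') :=
  h.trans_union (h'.mono_source Set.subset_union_left)

theorem biUnion {ι : Type*} {s : Finset ι} {T : ι → Set (MvPolynomial σ k)}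
    (h : ∀ i ∈ s, Derives S (T i) c) : Derives S (⋃ i ∈ s, T i) (s.card * c) := by
  classical
  induction s using Finset.induction_on with
  | empty => exact of_subset (by simp) _
  | insert a s ha ih =>
    rw [Finset.set_biUnion_insert, Finset.card_insert_of_notMem ha, add_one_mul, add_comm]
    exact (h a (Finset.mem_insert_self a s)).union
      (ih fun i hi => h i (Finset.mem_insert_of_mem hi))

theorem iUnion {ι : Type*} [Fintype ι] {T : ι → Set (MvPolynomial σ k)}
    (h : ∀ i, Derives S (T i) c) : Derives S (⋃ i, T i) (Fintype.card ι * c) := by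
  simpa using biUnion fun i (_ : i ∈ Finset.univ) => h i

theorem range {ι : Type*} [Fintype ι] {p : ι → MvPolynomial σ k}
    (h : ∀ i, Derives S {p i} c) : Derives S (Set.range p) (Fintype.card ι * c) := by
  simpa using iUnion h

theorem gate {p : MvPolynomial σ k}
    (h : ∀ (m : ℕ) (C : AlgCircuit k σ m), S ⊆ Set.range C.value →
      ∃ g : AlgGate k σ m, g.eval C.value = p ∧ 1 + g.fanIn ≤ c) : Derives S {p} c := by
  intro m C hC
  obtain ⟨g, hg, hc⟩ := h m C hC
  refine ⟨m + 1, C.snoc g, ?_, ?_, by simpa [AlgCircuit.size] using hc⟩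
  · rintro _ ⟨i, rfl⟩
    exact ⟨i.castSucc, by simp [AlgCircuit.value]⟩
  · rintro _ rfl
    exact ⟨Fin.last m, by simp [AlgCircuit.value, hg]⟩

theorem X (S : Set (MvPolynomial σ k)) (i : σ) : Derives S {MvPolynomial.X i} 1 :=
  gate fun _ _ _ => ⟨.var i, rfl, le_rfl⟩

theorem range_X [Fintype σ] (S : Set (MvPolynomial σ k)) :
    Derives S (Set.range MvPolynomial.X) (Fintype.card σ) := by
  simpa using range fun i => X S i

theorem C (S : Set (MvPolynomial σ k)) (a : k) : Derives S {MvPolynomial.C a} 1 :=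
  gate fun _ _ _ => ⟨.const a, rfl, le_rfl⟩

theorem list_sum {ι : Type*} {l : List ι} (a : ι → k) {p : ι → MvPolynomial σ k}
    (h : ∀ i ∈ l, p i ∈ S) :
    Derives S {(l.map fun i => MvPolynomial.C (a i) * p i).sum} (1 + l.length) := by
  refine gate fun m C hC => ?_
  have hl : l.map (fun i => (a i, p i)) ∈ Set.range (List.map (Prod.map id C.value)) := by
    rw [Set.range_list_map]
    simp only [Set.mem_ofPred_eq, List.forall_mem_map]
    intro i hi
    obtain ⟨r, hr⟩ := hC (h i hi)
    exact ⟨(a i, r), by simp [hr]⟩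
  obtain ⟨l', hl'⟩ := hl
  refine ⟨.sum l', ?_, by simpa [AlgGate.fanIn] using (congrArg List.length hl').le⟩
  simpa [AlgGate.eval, Function.comp_def] using
    congrArg (fun l => (l.map fun b => MvPolynomial.C b.1 * b.2).sum) hl'

theorem list_prod {ι : Type*} {l : List ι} {p : ι → MvPolynomial σ k} (h : ∀ i ∈ l, p i ∈ S) :
    Derives S {(l.map p).prod} (1 + l.length) := by
  refine gate fun m C hC => ?_
  have hl : l.map p ∈ Set.range (List.map C.value) := by
    rw [Set.range_list_map]
    simpa only [Set.mem_ofPred_eq, List.forall_mem_map] using fun i hi => hC (h i hi)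
  obtain ⟨l', hl'⟩ := hl
  refine ⟨.prod l', by rw [AlgGate.eval, hl'], ?_⟩
  simpa [AlgGate.fanIn] using (congrArg List.length hl').le

theorem finset_sum {ι : Type*} {s : Finset ι} (a : ι → k) {p : ι → MvPolynomial σ k}
    (h : ∀ i ∈ s, p i ∈ S) :
    Derives S {∑ i ∈ s, MvPolynomial.C (a i) * p i} (1 + s.card) := by
  simpa using list_sum (l := s.toList) a fun i hi => h i (Finset.mem_toList.1 hi)

theorem linearCombination₂ {p q : MvPolynomial σ k} (a b : k) (hp : p ∈ S) (hq : q ∈ S) :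
    Derives S {MvPolynomial.C a * p + MvPolynomial.C b * q} 3 := by
  simpa using list_sum (l := [(a, p), (b, q)]) Prod.fst (p := Prod.snd) (by simp [hp, hq])

theorem mul {p q : MvPolynomial σ k} (hp : p ∈ S) (hq : q ∈ S) : Derives S {p * q} 3 := by
  simpa using list_prod (l := [p, q]) (p := id) (by simp [hp, hq])

theorem pow {p : MvPolynomial σ k} (hp : p ∈ S) (m : ℕ) : Derives S {p ^ m} (1 + m) := by
  simpa using list_prod (l := List.range m) (p := fun _ => p) fun _ _ => hp

theorem mul_pow {p q : MvPolynomial σ k} (hp : p ∈ S) (hq : q ∈ S) (m : ℕ) :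
    Derives S {p * q ^ m} (m + 2) := by
  have := list_prod (S := S) (l := p :: List.replicate m q) (p := id) (by grind)
  simpa using this.mono_cost (by simp; lia)

theorem finset_sum_mul {ι : Type*} {s : Finset ι} (a : ι → k) {p q : ι → MvPolynomial σ k}
    (hp : ∀ i ∈ s, p i ∈ S) (hq : ∀ i ∈ s, q i ∈ S) :
    Derives S {∑ i ∈ s, MvPolynomial.C (a i) * (p i * q i)} (1 + 4 * s.card) := by
  have hprods : Derives S (⋃ i ∈ s, {p i * q i}) (s.card * 3) :=
    biUnion fun i hi => mul (hp i hi) (hq i hi)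
  refine (hprods.trans (finset_sum a fun i hi => ?_)).mono_cost (by lia)
  exact Set.mem_biUnion (s := (s : Set ι)) hi rfl

theorem exists_circuit (h : Derives ∅ T c) :
    ∃ (m : ℕ) (D : AlgCircuit k σ m), T ⊆ Set.range D.value ∧ D.size ≤ c := by
  obtain ⟨m, D, -, hTD, hsize⟩ := h 0 .nil (Set.empty_subset _)
  exact ⟨m, D, hTD, by simpa [AlgCircuit.size] using hsize⟩

theorem circuitSize_le {p : MvPolynomial σ k} (h : Derives ∅ {p} c) : circuitSize p ≤ c := by
  classical
  obtain ⟨m, D, hpD, hsize⟩ := h.exists_circuit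
  obtain ⟨r, hr⟩ := hpD rfl
  exact (Nat.find_min' _ ⟨m, D, r, hr, rfl⟩).trans hsize

end Derives

theorem hasCircuitOfSize_circuitSize (f : MvPolynomial σ k) :
    HasCircuitOfSize f (circuitSize f) := by
  classical
  exact Nat.find_spec (exists_hasCircuitOfSize f)

end CircuitExtension

section TruncatedSubstitution

variable {k σ τ : Type*} [CommSemiring k] {S : Set (MvPolynomial σ k)} {d : ℕ}

/-- The coefficients of `q` in degrees at most `d`. A circuit computes `q` modulo `X ^ (d + 1)` by
computing this set. -/
def coeffsUpTo {A : Type*} [Semiring A] (d : ℕ) (q : Polynomial A) : Set A :=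
  q.coeff '' Set.Iic d

theorem coeff_mem_coeffsUpTo {A : Type*} [Semiring A] {j : ℕ} (q : Polynomial A) (h : j ≤ d) :
    q.coeff j ∈ coeffsUpTo d q :=
  ⟨j, h, rfl⟩

namespace Derives

theorem coeffsUpTo_of_coeff {q : Polynomial (MvPolynomial σ k)} {c : ℕ}
    (h : ∀ j ≤ d, Derives S {q.coeff j} c) : Derives S (coeffsUpTo d q) ((d + 1) * c) := by
  have hrange := biUnion (s := Finset.range (d + 1)) (T := fun j => {q.coeff j}) fun j hj =>
    h j (Nat.lt_succ_iff.1 (Finset.mem_range.1 hj))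
  rw [Finset.card_range] at hrange
  refine hrange.mono_target ?_
  rintro _ ⟨j, hj, rfl⟩
  exact Set.mem_biUnion (s := (Finset.range (d + 1) : Set ℕ))
    (Finset.mem_coe.2 (Finset.mem_range.2 (Nat.lt_succ_iff.2 hj))) rfl

theorem coeffsUpTo_C (a : k) :
    Derives S (coeffsUpTo d (Polynomial.C (MvPolynomial.C a))) (d + 1) := by
  refine (coeffsUpTo_of_coeff (c := 1) fun j _ => ?_).mono_cost (by lia)
  rw [Polynomial.coeff_C]
  split_ifs
  · exact C S a
  · simpa using C S 0

theorem coeffsUpTo_list_sum {ι : Type*} {l : List ι} (a : ι → k)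
    {q : ι → Polynomial (MvPolynomial σ k)} (h : ∀ i ∈ l, coeffsUpTo d (q i) ⊆ S) :
    Derives S (coeffsUpTo d (l.map fun i => a i • q i).sum) ((d + 1) * (1 + l.length)) := by
  refine coeffsUpTo_of_coeff fun j hj => ?_
  rw [← Polynomial.lcoeff_apply, map_list_sum]
  simpa [Function.comp_def, MvPolynomial.C_mul'] using
    list_sum a fun i hi => h i hi (coeff_mem_coeffsUpTo (q i) hj)

theorem coeffsUpTo_mul {p q : Polynomial (MvPolynomial σ k)} (hp : coeffsUpTo d p ⊆ S)
    (hq : coeffsUpTo d q ⊆ S) :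
    Derives S (coeffsUpTo d (p * q)) (5 * (d + 1) ^ 2) := by
  refine (coeffsUpTo_of_coeff (c := 5 * (d + 1)) fun j hj => ?_).mono_cost (by lia)
  have hconv : Derives S {∑ a ∈ Finset.HasAntidiagonal.antidiagonal j,
      MvPolynomial.C 1 * (p.coeff a.1 * q.coeff a.2)} (1 + 4 * (j + 1)) := by
    rw [← Finset.Nat.card_antidiagonal]
    refine finset_sum_mul _ (fun a ha => hp (coeff_mem_coeffsUpTo p ?_))
      fun a ha => hq (coeff_mem_coeffsUpTo q ?_)
    · exact (Finset.HasAntidiagonal.antidiagonal.fst_le ha).trans hj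
    · exact (Finset.HasAntidiagonal.antidiagonal.snd_le ha).trans hj
  simpa only [Polynomial.coeff_mul, map_one, one_mul] using hconv.mono_cost (by lia)

theorem coeffsUpTo_list_prod {ι : Type*} {l : List ι} {q : ι → Polynomial (MvPolynomial σ k)}
    (h : ∀ i ∈ l, coeffsUpTo d (q i) ⊆ S) :
    Derives S (coeffsUpTo d (l.map q).prod) (5 * (d + 1) ^ 2 * (1 + l.length)) := by
  induction l with
  | nil => simpa using (coeffsUpTo_C (S := S) 1).mono_cost (by nlinarith)
  | cons i l ih =>
    have htail := ih fun j hj => h j (List.mem_cons_of_mem _ hj)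
    have hmul := coeffsUpTo_mul ((h i List.mem_cons_self).trans Set.subset_union_left)
      (Set.subset_union_right (s := S) (t := coeffsUpTo d (l.map q).prod))
    rw [List.map_cons, List.prod_cons, List.length_cons]
    exact (htail.trans_of_union hmul).mono_cost (by lia)

theorem coeffsUpTo_gate {m : ℕ} {v : τ → Polynomial (MvPolynomial σ k)}
    (hv : ∀ i, coeffsUpTo d (v i) ⊆ S) (g : AlgGate k τ m) {w : Fin m → MvPolynomial τ k}
    (hw : ∀ r, coeffsUpTo d (MvPolynomial.aeval v (w r)) ⊆ S) :
    Derives S (coeffsUpTo d (MvPolynomial.aeval v (g.eval w)))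
      (5 * (d + 1) ^ 2 * (1 + g.fanIn)) := by
  have hd : d + 1 ≤ 5 * (d + 1) ^ 2 := by nlinarith
  cases g with
  | var i => exact of_subset (by simpa [AlgGate.eval] using hv i) _
  | const a =>
    simpa [AlgGate.eval, AlgGate.fanIn, Polynomial.algebraMap_apply,
      MvPolynomial.algebraMap_apply] using (coeffsUpTo_C (S := S) a).mono_cost hd
  | sum l =>
    simpa [AlgGate.eval, AlgGate.fanIn, map_list_sum, Function.comp_def, Algebra.smul_def] using
      (coeffsUpTo_list_sum (l := l) Prod.fst fun a _ => hw a.2).mono_cost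
        (Nat.mul_le_mul_right _ hd)
  | prod l =>
    simpa [AlgGate.eval, AlgGate.fanIn, map_list_prod, Function.comp_def] using
      coeffsUpTo_list_prod (l := l) fun r _ => hw r

theorem coeffsUpTo_circuit {v : τ → Polynomial (MvPolynomial σ k)}
    (hv : ∀ i, coeffsUpTo d (v i) ⊆ S) {m : ℕ} (C : AlgCircuit k τ m) :
    Derives S (⋃ r, coeffsUpTo d (MvPolynomial.aeval v (C.value r)))
      (5 * (d + 1) ^ 2 * C.size) := by
  induction C with
  | nil => exact of_subset (by simp) _
  | @snoc m C g ih =>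
    have hlast := coeffsUpTo_gate (fun i => (hv i).trans Set.subset_union_left) g fun r =>
      (Set.subset_iUnion (fun r => coeffsUpTo d (MvPolynomial.aeval v (C.value r))) r).trans
        (Set.subset_union_right (s := S))
    rw [AlgCircuit.size, mul_add]
    refine (ih.trans_union hlast).mono_target (Set.iUnion_subset fun r => ?_)
    refine Fin.lastCases ?_ (fun r => ?_) r
    · simp [AlgCircuit.value]
    · simp only [AlgCircuit.value, Fin.snoc_castSucc]
      exact (Set.subset_iUnion (fun r => coeffsUpTo d (MvPolynomial.aeval v (C.value r)))
        r).trans Set.subset_union_left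

theorem coeffsUpTo_aeval_of_derives {T : Set (MvPolynomial τ k)} {c : ℕ} (hT : Derives ∅ T c)
    {v : τ → Polynomial (MvPolynomial σ k)} (hv : ∀ i, coeffsUpTo d (v i) ⊆ S) :
    Derives S (⋃ q ∈ T, coeffsUpTo d (MvPolynomial.aeval v q)) (5 * (d + 1) ^ 2 * c) := by
  obtain ⟨m, D, hTD, hsize⟩ := hT.exists_circuit
  refine ((coeffsUpTo_circuit hv D).mono_target ?_).mono_cost (Nat.mul_le_mul_left _ hsize)
  refine Set.iUnion₂_subset fun q hq => ?_
  obtain ⟨r, rfl⟩ := hTD hq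
  exact Set.subset_iUnion (fun r => coeffsUpTo d (MvPolynomial.aeval v (D.value r))) r

theorem coeffsUpTo_aeval {v : τ → Polynomial (MvPolynomial σ k)}
    (hv : ∀ i, coeffsUpTo d (v i) ⊆ S) (f : MvPolynomial τ k) :
    Derives S (coeffsUpTo d (MvPolynomial.aeval v f)) (5 * (d + 1) ^ 2 * circuitSize f) := by
  obtain ⟨m, D, r, rfl, hsize⟩ := hasCircuitOfSize_circuitSize f
  rw [← hsize]
  exact (coeffsUpTo_circuit hv D).mono_target
    (Set.subset_iUnion (fun r => coeffsUpTo d (MvPolynomial.aeval v (D.value r))) r)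

end Derives

end TruncatedSubstitution

section Vieta

open Polynomial

variable {B : Type*} [CommRing B] {n : ℕ}

/-- The elementary symmetric functions, of degrees `1, …, n`, of `n` elements of a ring. -/
def esymmTuple (z : Fin n → B) (i : Fin n) : B :=
  (Finset.univ.val.map z).esymm (i + 1)

/-- The monic polynomial `X ^ n - s 0 * X ^ (n - 1) + s 1 * X ^ (n - 2) - …` prescribed by Vieta's
formulas: if the elementary symmetric functions of `z` are `s`, then its roots are the `z i`. -/
noncomputable def vietaPoly (s : Fin n → B) : B[X] :=
  X ^ n + ∑ i : Fin n, C ((-1) ^ (i + 1 : ℕ) * s i) * X ^ (n - (i + 1 : ℕ))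

theorem vietaPoly_esymmTuple (z : Fin n → B) :
    vietaPoly (esymmTuple z) = Lagrange.nodal Finset.univ z := by
  have h := Multiset.prod_X_sub_X_eq_sum_esymm (Finset.univ.val.map z)
  have hcard : (Finset.univ.val.map z).card = n := by simp
  rw [Multiset.map_map, hcard, Finset.sum_range_succ', Finset.sum_range, add_comm] at h
  rw [Lagrange.nodal_eq, Finset.prod, ← Function.comp_def (fun t => X - C t) z, h]
  simp [vietaPoly, esymmTuple, Multiset.esymm, mul_assoc]

theorem degree_sum_C_mul_X_pow_lt (s : Fin n → B) :
    degree (∑ i : Fin n, C ((-1) ^ (i + 1 : ℕ) * s i) * X ^ (n - (i + 1 : ℕ))) < n := by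
  rw [degree_lt_iff_coeff_zero]
  intro m hm
  rw [finsetSum_coeff]
  refine Finset.sum_eq_zero fun i _ => ?_
  rw [coeff_C_mul_X_pow, if_neg (by lia)]

theorem vietaPoly_monic (s : Fin n → B) : (vietaPoly s).Monic :=
  monic_X_pow_add (degree_sum_C_mul_X_pow_lt s)

theorem natDegree_vietaPoly_le (s : Fin n → B) : (vietaPoly s).natDegree ≤ n :=
  natDegree_le_iff_degree_le.2 <| (degree_add_le _ _).trans <|
    max_le (degree_X_pow_le n) (degree_sum_C_mul_X_pow_lt s).le

theorem coeff_vietaPoly (s : Fin n → B) (i : Fin n) :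
    (vietaPoly s).coeff (n - (i + 1 : ℕ)) = (-1) ^ (i + 1 : ℕ) * s i := by
  rw [vietaPoly, coeff_add, coeff_X_pow, if_neg (by lia), zero_add, finsetSum_coeff,
    Finset.sum_eq_single i]
  · rw [coeff_C_mul_X_pow, if_pos rfl]
  · intro j _ hj
    rw [coeff_C_mul_X_pow, if_neg]
    exact fun h => hj (Fin.ext (by lia))
  · simp

theorem vietaPoly_injective : Function.Injective (vietaPoly : (Fin n → B) → B[X]) := by
  intro s s' h
  funext i
  have hcoeff := congrArg (coeff · (n - (i + 1 : ℕ))) h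
  simp only [coeff_vietaPoly] at hcoeff
  exact (isUnit_one.neg.pow _).mul_right_inj.1 hcoeff

theorem eval_vietaPoly (s : Fin n → B) (x : B) :
    (vietaPoly s).eval x =
      x ^ n + ∑ i : Fin n, (-1) ^ (i + 1 : ℕ) * s i * x ^ (n - (i + 1 : ℕ)) := by
  simp [vietaPoly, eval_finsetSum]

theorem map_vietaPoly {B' : Type*} [CommRing B'] (φ : B →+* B') (s : Fin n → B) :
    (vietaPoly s).map φ = vietaPoly fun i => φ (s i) := by
  simp [vietaPoly, Polynomial.map_sum]

theorem esymmTuple_eq_of_roots {s z : Fin n → B} (hz : Pairwise fun i j => IsUnit (z i - z j))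
    (h : ∀ i, (vietaPoly s).eval (z i) = 0) : esymmTuple z = s := by
  nontriviality B
  have hdvd : Lagrange.nodal Finset.univ z ∣ vietaPoly s :=
    Finset.prod_dvd_of_coprime (fun i _ j _ hij => isCoprime_X_sub_C_of_isUnit_sub (hz hij))
      fun i _ => dvd_iff_isRoot.2 (h i)
  have heq : vietaPoly s = Lagrange.nodal Finset.univ z :=
    eq_of_monic_of_dvd_of_natDegree_le Lagrange.nodal_monic (vietaPoly_monic s) hdvd
      (by simpa using natDegree_vietaPoly_le s)
  exact vietaPoly_injective ((vietaPoly_esymmTuple z).trans heq.symm)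

theorem C_dvd_vietaPoly_sub {s s' : Fin n → B} {t : B} (h : ∀ i, t ∣ s i - s' i) :
    C t ∣ vietaPoly s - vietaPoly s' := by
  rw [vietaPoly, vietaPoly, add_sub_add_left_eq_sub, ← Finset.sum_sub_distrib]
  refine Finset.dvd_sum fun i _ => ?_
  rw [← sub_mul, ← C_sub, ← mul_sub]
  exact (map_dvd C ((h i).mul_left _)).mul_right _

theorem isUnit_eval_derivative_vietaPoly_esymmTuple {z : Fin n → B}
    (hz : Pairwise fun i j => IsUnit (z i - z j)) (i : Fin n) :
    IsUnit ((vietaPoly (esymmTuple z)).derivative.eval (z i)) := by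
  rw [vietaPoly_esymmTuple, Lagrange.eval_nodal_derivative_eval_node_eq (Finset.mem_univ i),
    Lagrange.eval_nodal]
  exact (IsUnit.prod_iff).2 fun j hj => hz (Finset.ne_of_mem_erase hj).symm

end Vieta

section Newton

open MvPolynomial

theorem newton_step {B : Type*} [CommRing B] (P : Polynomial B) {t z a u : B} {m : ℕ} (hm : m ≠ 0)
    (hz : t ∣ z - a) (hu : t ∣ 1 - u * P.derivative.eval a) (h : t ^ m ∣ P.eval z) :
    t ∣ z - u * P.eval z - a ∧ t ^ (m + 1) ∣ P.eval (z - u * P.eval z) := by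
  have ht : t ∣ P.eval z := (dvd_pow_self t hm).trans h
  refine ⟨by simpa only [sub_right_comm] using dvd_sub hz (ht.mul_left u), ?_⟩
  have hslope : t ∣ 1 - u * P.derivative.eval z := by
    have hPz := dvd_sub hu ((hz.trans (P.derivative.sub_dvd_eval_sub z a)).mul_left u)
    rwa [mul_sub, sub_sub, add_sub_cancel] at hPz
  obtain ⟨q, hq⟩ := P.binomExpansion z (-(u * P.eval z))
  have hfactor : P.eval (z - u * P.eval z) =
      P.eval z * (1 - u * P.derivative.eval z + q * u ^ 2 * P.eval z) := by
    rw [sub_eq_add_neg, hq]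
    ring
  rw [hfactor, pow_succ]
  exact mul_dvd_mul h (dvd_add hslope (ht.mul_left _))

theorem isUnit_quotient_mk_of_dvd_sub {B : Type*} [CommRing B] {t x y : B} (m : ℕ)
    (hy : IsUnit y) (h : t ∣ x - y) : IsUnit (Ideal.Quotient.mk (Ideal.span {t ^ m}) x) := by
  have hnil : IsNilpotent (Ideal.Quotient.mk (Ideal.span {t ^ m}) (x - y)) := by
    refine ⟨m, ?_⟩
    rw [← map_pow, Ideal.Quotient.eq_zero_iff_dvd]
    exact pow_dvd_pow_of_dvd h m
  have hunit := hnil.isUnit_add_left_of_commute (hy.map (Ideal.Quotient.mk (Ideal.span {t ^ m})))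
    (Commute.all _ _)
  rwa [← map_add, add_sub_cancel] at hunit

variable {k B : Type*} [CommRing k] [CommRing B] [Algebra k B] {n : ℕ} {a : Fin n → k}

/-- The inverse of the derivative at `a i` of the polynomial with roots `a`, for unit differences
of the `a i`. (If the derivative is not a unit, `Ring.inverse` makes this `0`.) -/
noncomputable def newtonSlope (a : Fin n → k) (i : Fin n) : k :=
  Ring.inverse ((vietaPoly (esymmTuple a)).derivative.eval (a i))

/-- The approximations of the `i`th root of the generic monic polynomial `vietaPoly X` by Newton's
iteration started at `a i`, with the slope at `a` used in every step. -/
noncomputable def newtonRoot (a : Fin n → k) (i : Fin n) : ℕ → MvPolynomial (Fin n) k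
  | 0 => C (a i)
  | m + 1 => newtonRoot a i m - C (newtonSlope a i) * (vietaPoly X).eval (newtonRoot a i m)

theorem aeval_newtonRoot_succ (a : Fin n → k) (i : Fin n) (m : ℕ) (s : Fin n → B) :
    aeval s (newtonRoot a i (m + 1)) = aeval s (newtonRoot a i m) -
      algebraMap k B (newtonSlope a i) * (vietaPoly s).eval (aeval s (newtonRoot a i m)) := by
  simp [newtonRoot, eval_vietaPoly]

theorem dvd_aeval_newtonRoot (ha : Pairwise fun i j => IsUnit (a i - a j)) (i : Fin n) {t : B}
    {s : Fin n → B} (hs : ∀ j, t ∣ s j - algebraMap k B (esymmTuple a j)) (m : ℕ) :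
    t ∣ aeval s (newtonRoot a i m) - algebraMap k B (a i) ∧
      t ^ (m + 1) ∣ (vietaPoly s).eval (aeval s (newtonRoot a i m)) := by
  obtain ⟨q, hq⟩ := C_dvd_vietaPoly_sub hs
  rw [← map_vietaPoly, sub_eq_iff_eq_add'] at hq
  have hinv : newtonSlope a i * (vietaPoly (esymmTuple a)).derivative.eval (a i) = 1 :=
    Ring.inverse_mul_cancel _ (isUnit_eval_derivative_vietaPoly_esymmTuple ha i)
  induction m with
  | zero =>
    have hroot : (vietaPoly (esymmTuple a)).eval (a i) = 0 := by
      rw [vietaPoly_esymmTuple, Lagrange.eval_nodal_at_node (Finset.mem_univ i)]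
    simp only [newtonRoot, aeval_C, sub_self, dvd_zero, zero_add, pow_one, true_and, hq,
      Polynomial.eval_add, Polynomial.eval_map_apply, hroot, map_zero, Polynomial.eval_mul,
      Polynomial.eval_C, dvd_mul_right]
  | succ m ih =>
    rw [aeval_newtonRoot_succ]
    refine newton_step _ m.succ_ne_zero ih.1 ?_ ih.2
    simp only [hq, Polynomial.derivative_add, Polynomial.derivative_map, Polynomial.eval_add,
      Polynomial.eval_map_apply, mul_add, ← map_mul, hinv, map_one,
      Polynomial.derivative_C_mul, Polynomial.eval_mul, Polynomial.eval_C]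
    exact ⟨-(algebraMap k B (newtonSlope a i) * q.derivative.eval (algebraMap k B (a i))), by ring⟩

/-- Modulo `t ^ (m + 1)` the approximate roots are roots with unit differences of `vietaPoly s`,
hence their elementary symmetric functions are `s`. -/
theorem dvd_aeval_newtonRoot_sub (ha : Pairwise fun i j => IsUnit (a i - a j)) {t : B}
    {s : Fin n → B} (hs : ∀ j, t ∣ s j - algebraMap k B (esymmTuple a j)) (m : ℕ)
    (p : MvPolynomial (Fin n) k) :
    t ^ (m + 1) ∣ aeval (fun i => aeval s (newtonRoot a i m))
        (aeval (fun i : Fin n => esymm (Fin n) k (i + 1)) p) - aeval s p := by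
  have hroot := fun i => dvd_aeval_newtonRoot ha i hs m
  let Q := Ideal.Quotient.mkₐ k (Ideal.span {t ^ (m + 1)})
  let z := fun i => aeval s (newtonRoot a i m)
  have hunit : Pairwise fun i j => IsUnit (Q (z i) - Q (z j)) := by
    intro i j hij
    rw [← map_sub]
    refine isUnit_quotient_mk_of_dvd_sub _ ((ha hij).map (algebraMap k B)) ?_
    rw [map_sub, sub_sub_sub_comm]
    exact dvd_sub (hroot i).1 (hroot j).1
  have hzero (i : Fin n) : (vietaPoly fun j => Q (s j)).eval (Q (z i)) = 0 := by
    have heval := Polynomial.eval_map_apply Q.toRingHom (z i) (p := vietaPoly s)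
    rw [map_vietaPoly] at heval
    exact heval.trans ((Ideal.Quotient.eq_zero_iff_dvd _ _).2 (hroot i).2)
  have hesymm (i : Fin n) : aeval (fun j => Q (z j)) (esymm (Fin n) k (i + 1)) = Q (s i) :=
    (aeval_esymm_eq_multiset_esymm (Fin n) k _ _).trans
      (congrFun (esymmTuple_eq_of_roots hunit hzero) i)
  rw [← Ideal.Quotient.eq_zero_iff_dvd, ← Ideal.Quotient.mkₐ_eq_mk k, map_sub, sub_eq_zero]
  change Q (aeval z _) = Q _
  simp only [← AlgHom.comp_apply, comp_aeval, hesymm]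

end Newton

section SymmetricGenerators

open MvPolynomial Finset

variable (σ R : Type*) [Fintype σ] [CommRing R]

theorem prod_one_sub_X_mul_C_X :
    ∏ i : σ, (1 - PowerSeries.X * PowerSeries.C (X i : MvPolynomial σ R)) =
      PowerSeries.mk fun j => (-1) ^ j * esymm σ R j := by
  ext j : 1
  have hterm (t : Finset σ) :
      ∏ i ∈ t, -(PowerSeries.X * PowerSeries.C (X i : MvPolynomial σ R)) =
        PowerSeries.C ((-1) ^ #t * ∏ i ∈ t, X i) * PowerSeries.X ^ #t := by
    simp only [prod_neg, prod_mul_distrib, prod_const, map_mul, map_pow, map_neg, map_one, map_prod]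
    ring
  simp only [sub_eq_add_neg, prod_one_add, hterm, map_sum, PowerSeries.coeff_C_mul,
    PowerSeries.coeff_X_pow, PowerSeries.coeff_mk, mul_ite, mul_one, mul_zero]
  rw [← sum_filter, esymm, mul_sum, ← univ_filter_card_eq, powerset_univ]
  refine sum_congr (by simp [eq_comm]) fun t ht => ?_
  rw [(mem_filter.1 ht).2]

theorem prod_mk_X_pow [DecidableEq σ] :
    ∏ i : σ, PowerSeries.mk (fun j => (X i : MvPolynomial σ R) ^ j) =
      PowerSeries.mk fun j => hsymm σ R j := by
  ext j : 1
  rw [PowerSeries.coeff_prod, PowerSeries.coeff_mk, hsymm, eq_comm]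
  simp only [PowerSeries.coeff_mk]
  refine sum_nbij (fun s => Multiset.toFinsupp s.1) (fun s _ => ?_) ?_ (fun e he => ?_)
    fun s _ => ?_
  · have hsum := (Multiset.toFinsupp_sum_eq s.1).trans s.2
    rw [Finsupp.sum_fintype _ _ fun _ => rfl] at hsum
    exact mem_finsuppAntidiag.2 ⟨hsum, subset_univ _⟩
  · exact fun s _ s' _ h => Subtype.ext (Multiset.toFinsupp.injective h)
  · have hcard := (mem_finsuppAntidiag.1 (mem_coe.1 he)).1
    have hcard' : (Finsupp.toMultiset e).card = j := by
      simpa [Finsupp.card_toMultiset, Finsupp.sum_fintype] using hcard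
    exact ⟨⟨Finsupp.toMultiset e, hcard'⟩, mem_coe.2 (mem_univ _), by simp⟩
  · rw [Finset.prod_multiset_map_count]
    exact prod_subset (subset_univ _) fun i _ hi => by simp_all

/-- Multiply the generating functions `∏ (1 - xᵢ t)` and `∏ (1 - xᵢ t)⁻¹`. -/
theorem sum_antidiagonal_esymm_mul_hsymm [DecidableEq σ] {m : ℕ} (hm : m ≠ 0) :
    ∑ a ∈ antidiagonal m, (-1) ^ a.1 * esymm σ R a.1 * hsymm σ R a.2 = 0 := by
  have hinv (i : σ) : (1 - PowerSeries.X * PowerSeries.C (X i : MvPolynomial σ R)) *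
      PowerSeries.mk (fun j => (X i : MvPolynomial σ R) ^ j) = 1 := by
    rw [sub_mul, one_mul, mul_assoc, sub_eq_iff_eq_add]
    ext j : 1
    cases j <;> simp [PowerSeries.coeff_succ_X_mul, PowerSeries.coeff_one, pow_succ']
  have hprod := Finset.prod_congr rfl fun i (_ : i ∈ (univ : Finset σ)) => hinv i
  rw [prod_mul_distrib, prod_one_sub_X_mul_C_X, prod_mk_X_pow, prod_const_one] at hprod
  simpa [PowerSeries.coeff_mul, PowerSeries.coeff_one, hm] using
    congrArg (PowerSeries.coeff m) hprod

variable {R} {n : ℕ}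

theorem esymm_succ_eq_sum_hsymm [DecidableEq σ] (m : ℕ) :
    esymm σ R (m + 1) = ∑ a ∈ antidiagonal m,
      C ((-1) ^ a.2) * (esymm σ R a.1 * hsymm σ R (a.2 + 1)) := by
  have h := sum_antidiagonal_esymm_mul_hsymm σ R m.succ_ne_zero
  rw [Nat.succ_eq_add_one, Nat.sum_antidiagonal_succ', hsymm_zero, mul_one, add_comm,
    ← eq_neg_iff_add_eq_zero, ← neg_eq_iff_eq_neg] at h
  have hsign (l : ℕ) : ((-1) ^ l * (-1) ^ l : MvPolynomial σ R) = 1 := by simp [← mul_pow]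
  calc
    esymm σ R (m + 1) = (-1) ^ (m + 1) * ((-1) ^ (m + 1) * esymm σ R (m + 1)) := by
      rw [← mul_assoc, hsign, one_mul]
    _ = _ := by
      rw [← h, ← sum_neg_distrib, mul_sum]
      refine sum_congr rfl fun a ha => ?_
      rw [← mem_antidiagonal.1 ha, C_pow, C_neg, C_1]
      linear_combination (-1) ^ a.2 * esymm σ R a.1 * hsymm σ R (a.2 + 1) * hsign a.1

theorem esymm_succ_eq_sum_psum [Algebra ℚ R] (m : ℕ) :
    esymm σ R (m + 1) = ∑ a ∈ antidiagonal m,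
      C (algebraMap ℚ R ((-1) ^ a.2 / (a.1 + a.2 + 1))) *
        (esymm σ R a.1 * psum σ R (a.2 + 1)) := by
  classical
  have hsign (l : ℕ) : ((-1) ^ l * (-1) ^ l : MvPolynomial σ R) = 1 := by simp [← mul_pow]
  have h := mul_esymm_eq_sum σ R (m + 1)
  rw [sum_filter, Nat.sum_antidiagonal_succ', if_neg (lt_irrefl _), zero_add, mul_sum] at h
  have hinv : C (algebraMap ℚ R (1 / (m + 1))) * ((m + 1 : ℕ) : MvPolynomial σ R) = 1 := by
    rw [← map_natCast C, ← map_natCast (algebraMap ℚ R), ← C_mul, ← map_mul]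
    simp [Nat.cast_add_one_ne_zero]
  rw [← one_mul (esymm σ R (m + 1)), ← hinv, mul_assoc, h, mul_sum]
  refine sum_congr rfl fun a ha => ?_
  have ha := mem_antidiagonal.1 ha
  rw [if_pos (by lia), ← ha]
  have hcoeff : C (algebraMap ℚ R ((-1) ^ a.2 / (a.1 + a.2 + 1))) =
      C (algebraMap ℚ R (1 / (a.1 + a.2 + 1))) * (-1 : MvPolynomial σ R) ^ a.2 := by
    rw [← mul_one_div, mul_comm, map_mul, C_mul]
    simp only [map_pow, map_neg, map_one]
  rw [hcoeff, Nat.cast_add]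
  linear_combination C (algebraMap ℚ R (1 / (a.1 + a.2 + 1))) * (-1) ^ a.2 * esymm σ R a.1 *
    psum σ R (a.2 + 1) * hsign a.1

/-- The polynomials in `X 0, …, X (n - 1)` (the variables with index at least `n` being `0`)
obtained by solving the recursion `E 0 = 1`, `E (m + 1) = ∑ c (j, l) * E j * X l`, the sum being
over `j + l = m`. For suitable coefficients `c`, it expresses the elementary symmetric polynomials
through another family of generators. -/
noncomputable def newtonRec (c : ℕ × ℕ → R) : ℕ → MvPolynomial (Fin n) R
  | 0 => 1
  | m + 1 => ∑ j : Fin (m + 1), C (c (j, m - j)) *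
      (newtonRec c j * Function.extend Fin.val X 0 (m - j))

theorem newtonRec_succ (c : ℕ × ℕ → R) (m : ℕ) :
    (newtonRec c (m + 1) : MvPolynomial (Fin n) R) = ∑ a ∈ antidiagonal m,
      C (c a) * (newtonRec c a.1 * Function.extend Fin.val X 0 a.2) := by
  rw [newtonRec, Nat.sum_antidiagonal_eq_sum_range_succ_mk, sum_range]

theorem extend_val_X {l : ℕ} (hl : l < n) :
    Function.extend Fin.val (X : Fin n → MvPolynomial (Fin n) R) 0 l = X ⟨l, hl⟩ :=
  Fin.val_injective.extend_apply _ _ ⟨l, hl⟩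

theorem aeval_newtonRec {A : Type*} [CommSemiring A] [Algebra R A] {c : ℕ × ℕ → R} {e g : ℕ → A}
    (h₀ : e 0 = 1)
    (h : ∀ m, e (m + 1) = ∑ a ∈ antidiagonal m, algebraMap R A (c a) * (e a.1 * g a.2))
    {m : ℕ} (hm : m ≤ n) :
    aeval (fun i : Fin n => g i) (newtonRec c m) = e m := by
  induction m using Nat.strong_induction_on with
  | _ m ih =>
    cases m with
    | zero => simp [newtonRec, h₀]
    | succ m =>
      rw [h, newtonRec_succ, map_sum]
      refine sum_congr rfl fun a ha => ?_
      have := mem_antidiagonal.1 ha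
      rw [map_mul, map_mul, ih a.1 (by lia) (by lia), extend_val_X (by lia), aeval_C, aeval_X]

theorem aeval_newtonRec_surjective {c : ℕ × ℕ → R} (hc : ∀ m, IsUnit (c (0, m))) :
    Function.Surjective (aeval (R := R) fun i : Fin n =>
      (newtonRec c (i + 1) : MvPolynomial (Fin n) R)) := by
  set ε := aeval (R := R) fun i : Fin n => (newtonRec c (i + 1) : MvPolynomial (Fin n) R)
  have hrec {m : ℕ} (hm : m ≤ n) : newtonRec c m ∈ ε.range := by
    cases m with
    | zero => simpa only [newtonRec] using one_mem _
    | succ m => exact ⟨X ⟨m, hm⟩, by simp [ε]⟩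
  have hX (m : ℕ) : ∀ hm : m < n, X ⟨m, hm⟩ ∈ ε.range := by
    induction m using Nat.strong_induction_on with
    | _ m ih =>
      intro hm
      obtain ⟨u, hu⟩ := hc m
      have htail : ∑ a ∈ (antidiagonal m).erase (0, m),
          C (c a) * (newtonRec c a.1 * Function.extend Fin.val X 0 a.2) ∈ ε.range := by
        refine sum_mem fun a ha => mul_mem (algebraMap_mem _ _) (mul_mem (hrec ?_) ?_)
        · have := mem_antidiagonal.1 (mem_of_mem_erase ha)
          lia
        · have hlt : a.2 < m := by
            have := mem_antidiagonal.1 (mem_of_mem_erase ha)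
            have := ne_of_mem_erase ha
            grind
          rw [extend_val_X (hlt.trans hm)]
          exact ih a.2 hlt (hlt.trans hm)
      have hsolve := newtonRec_succ (n := n) c m
      rw [← add_sum_erase _ _ (show (0, m) ∈ antidiagonal m by simp), extend_val_X hm,
        newtonRec, one_mul, ← hu] at hsolve
      have : C ((u⁻¹ : Rˣ) : R) * (newtonRec c (m + 1) - ∑ a ∈ (antidiagonal m).erase (0, m),
          C (c a) * (newtonRec c a.1 * Function.extend Fin.val X 0 a.2)) = X ⟨m, hm⟩ := by
        rw [hsolve, add_sub_cancel_right, ← mul_assoc, ← C_mul, Units.inv_mul, C_1, one_mul]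
      rw [← this]
      exact mul_mem (algebraMap_mem _ _) (sub_mem (hrec hm) htail)
  rw [← AlgHom.range_eq_top, eq_top_iff, ← adjoin_range_X, Algebra.adjoin_le_iff]
  rintro _ ⟨i, rfl⟩
  exact hX i i.2

theorem aeval_esymm_injective (n : ℕ) :
    Function.Injective (aeval (R := R) fun i : Fin n => esymm (Fin n) R (i + 1)) := by
  intro p q h
  refine esymmAlgHom_fin_injective R le_rfl (Subtype.ext ?_)
  simpa only [esymmAlgHom_apply] using h

theorem exists_aeval_esymm_eq {f : MvPolynomial (Fin n) R} (hf : f.IsSymmetric) :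
    ∃ p, aeval (R := R) (fun i : Fin n => esymm (Fin n) R (i + 1)) p = f := by
  obtain ⟨p, hp⟩ := (esymmAlgHom_fin_bijective R n).2 ⟨f, hf⟩
  exact ⟨p, by simpa only [esymmAlgHom_apply] using congrArg Subtype.val hp⟩

theorem aeval_esymm_eq_aeval_iff {c : ℕ × ℕ → R} {g : ℕ → MvPolynomial (Fin n) R}
    (hc : ∀ m, IsUnit (c (0, m)))
    (hg : ∀ m, esymm (Fin n) R (m + 1) =
      ∑ a ∈ antidiagonal m, C (c a) * (esymm (Fin n) R a.1 * g a.2))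
    (p q : MvPolynomial (Fin n) R) :
    aeval (fun i : Fin n => esymm (Fin n) R (i + 1)) p = aeval (fun i : Fin n => g i) q ↔
      q = aeval (fun i : Fin n => newtonRec c (i + 1)) p := by
  have hcomp (p : MvPolynomial (Fin n) R) : aeval (fun i : Fin n => g i)
      (aeval (fun i : Fin n => newtonRec c (i + 1)) p) =
        aeval (fun i : Fin n => esymm (Fin n) R (i + 1)) p := by
    have hrec (i : Fin n) : aeval (fun i : Fin n => g i) (newtonRec c (i + 1)) =
        esymm (Fin n) R (i + 1) :=
      aeval_newtonRec (esymm_zero (Fin n) R) hg i.2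
    simp only [comp_aeval_apply, hrec]
  obtain ⟨p', rfl⟩ := aeval_newtonRec_surjective hc q
  rw [hcomp, (aeval_esymm_injective n).eq_iff]
  refine ⟨fun h => by rw [h], fun h => aeval_esymm_injective n ?_⟩
  rw [← hcomp, ← hcomp, h]

theorem aeval_esymm_eq_aeval_hsymm_iff (p q : MvPolynomial (Fin n) R) :
    aeval (fun i : Fin n => esymm (Fin n) R (i + 1)) p =
        aeval (fun i : Fin n => hsymm (Fin n) R (i + 1)) q ↔
      q = aeval (fun i : Fin n => newtonRec (fun a => (-1) ^ a.2) (i + 1)) p :=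
  aeval_esymm_eq_aeval_iff (g := fun m => hsymm (Fin n) R (m + 1))
    (fun m => isUnit_one.neg.pow m) (esymm_succ_eq_sum_hsymm (Fin n)) p q

theorem aeval_esymm_eq_aeval_psum_iff [Algebra ℚ R] (p q : MvPolynomial (Fin n) R) :
    aeval (fun i : Fin n => esymm (Fin n) R (i + 1)) p =
        aeval (fun i : Fin n => psum (Fin n) R (i + 1)) q ↔
      q = aeval (fun i : Fin n => newtonRec
        (fun a => algebraMap ℚ R ((-1) ^ a.2 / (a.1 + a.2 + 1))) (i + 1)) p := by
  refine aeval_esymm_eq_aeval_iff (g := fun m => psum (Fin n) R (m + 1)) (fun m => ?_)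
    (esymm_succ_eq_sum_psum (Fin n)) p q
  have hne : ((-1) ^ m / (0 + m + 1) : ℚ) ≠ 0 := by positivity
  simpa using hne.isUnit.map (algebraMap ℚ R)

end SymmetricGenerators

section Cost

open MvPolynomial

variable {k σ : Type*} [CommRing k] {n d c : ℕ}

theorem derives_eval_vietaPoly {S : Set (MvPolynomial σ k)} {s : Fin n → MvPolynomial σ k}
    {z : MvPolynomial σ k} (hs : ∀ j, s j ∈ S) (hz : z ∈ S) :
    Derives S {(vietaPoly s).eval z} (5 * (n + 1) ^ 2) := by
  have hprods : Derives S (Set.range fun j : Fin n => s j * z ^ (n - (j + 1 : ℕ)))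
      (n * (n + 1)) := by
    simpa using Derives.range fun j : Fin n =>
      (Derives.mul_pow (hs j) hz (n - (j + 1 : ℕ))).mono_cost (show _ ≤ n + 1 by lia)
  have htail := hprods.trans <| Derives.finset_sum (s := Finset.univ)
    (fun j : Fin n => (-1) ^ (j + 1 : ℕ)) fun j _ => Set.mem_range_self j
  have heval := ((Derives.pow hz n).union htail).trans
    (Derives.linearCombination₂ 1 1 (Or.inl rfl) (Or.inr rfl))
  have heq : (vietaPoly s).eval z = C 1 * z ^ n + C 1 * ∑ j : Fin n,
      C ((-1) ^ (j + 1 : ℕ)) * (s j * z ^ (n - (j + 1 : ℕ))) := by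
    simp [eval_vietaPoly, mul_assoc]
  rw [heq]
  exact heval.mono_cost (by simp; nlinarith)

theorem derives_newtonRoot_succ (a : Fin n → k) (m : ℕ) :
    Derives (Set.range X ∪ Set.range fun i => newtonRoot a i m)
      (Set.range fun i => newtonRoot a i (m + 1)) (8 * (n + 1) ^ 3) := by
  set S := Set.range X ∪ Set.range fun i => newtonRoot a i m
  have hX (j : Fin n) : X j ∈ S := Or.inl (Set.mem_range_self j)
  have hroot (i : Fin n) : newtonRoot a i m ∈ S := Or.inr (Set.mem_range_self i)
  have hstep (i : Fin n) : Derives S {newtonRoot a i (m + 1)} (8 * (n + 1) ^ 2) := by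
    have heq : newtonRoot a i (m + 1) = C 1 * newtonRoot a i m +
        C (-newtonSlope a i) * (vietaPoly X).eval (newtonRoot a i m) := by
      simp [newtonRoot, sub_eq_add_neg]
    rw [heq]
    exact ((derives_eval_vietaPoly hX (hroot i)).trans_of_union
      (Derives.linearCombination₂ _ _ (Or.inl (hroot i)) (Or.inr rfl))).mono_cost (by grind)
  refine (Derives.range hstep).mono_cost ?_
  rw [Fintype.card_fin]
  nlinarith

theorem derives_newtonRoot (a : Fin n → k) (m : ℕ) :
    Derives ∅ (Set.range fun i => newtonRoot a i m) (8 * (n + 1) ^ 3 * (m + 1)) := by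
  have hX : Derives (Set.range X) (Set.range fun i => newtonRoot a i m)
      (n + m * (8 * (n + 1) ^ 3)) := by
    induction m with
    | zero => simpa [newtonRoot] using Derives.range fun i => Derives.C (Set.range X) (a i)
    | succ m ih => exact (ih.trans_of_union (derives_newtonRoot_succ a m)).mono_cost (by lia)
  refine ((Derives.range_X ∅).trans hX).mono_cost ?_
  rw [Fintype.card_fin]
  nlinarith [Nat.le_self_pow three_ne_zero (n + 1)]

theorem derives_newtonRec (c : ℕ × ℕ → k) :
    Derives ∅ (Set.range fun i : Fin n => newtonRec (n := n) c (i + 1)) (5 * (n + 1) ^ 2) := by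
  have hX (m : ℕ) (hm : m ≤ n) : Derives (Set.range (X : Fin n → MvPolynomial (Fin n) k))
      (newtonRec c '' Set.Iic m) (1 + m * (4 * n + 1)) := by
    induction m with
    | zero => simpa [newtonRec, Set.Iic, Nat.le_zero] using Derives.C (Set.range X) (1 : k)
    | succ m ih =>
      have hstep : Derives (Set.range X ∪ newtonRec c '' Set.Iic m)
          {newtonRec (n := n) c (m + 1)} (1 + 4 * (m + 1)) := by
        rw [newtonRec_succ, ← Finset.Nat.card_antidiagonal]
        refine Derives.finset_sum_mul c (fun b hb => Or.inr ⟨b.1, ?_, rfl⟩) fun b hb => Or.inl ?_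
        · exact Finset.HasAntidiagonal.antidiagonal.fst_le hb
        · have hb := Finset.HasAntidiagonal.antidiagonal.snd_le hb
          rw [extend_val_X (by lia)]
          exact Set.mem_range_self _
      refine (((ih (by lia)).trans_union hstep).mono_target ?_).mono_cost (by nlinarith)
      rw [← Nat.succ_eq_add_one, ← Nat.succ_eq_succ, Order.Iic_succ, Set.image_insert_eq,
        Set.union_singleton, Nat.succ_eq_succ]
  refine (((Derives.range_X ∅).trans (hX n le_rfl)).mono_target ?_).mono_cost ?_
  · rintro _ ⟨i, rfl⟩
    exact ⟨i + 1, i.2, rfl⟩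
  · rw [Fintype.card_fin]
    nlinarith

/-- The line from `esymmTuple a` at `X = 0` to `w` at `X = 1`. -/
noncomputable def esymmLine (a : Fin n → k) (w : Fin n → MvPolynomial σ k) (j : Fin n) :
    Polynomial (MvPolynomial σ k) :=
  Polynomial.C (C (esymmTuple a j)) + Polynomial.X * Polynomial.C (w j - C (esymmTuple a j))

theorem natDegree_esymmLine_le (a : Fin n → k) (w : Fin n → MvPolynomial σ k) (j : Fin n) :
    (esymmLine a w j).natDegree ≤ 1 := by
  unfold esymmLine
  compute_degree

theorem eval_one_aeval_esymmLine (a : Fin n → k) (w : Fin n → MvPolynomial σ k)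
    (p : MvPolynomial (Fin n) k) : (aeval (esymmLine a w) p).eval 1 = aeval w p := by
  have h := comp_aeval_apply (esymmLine a w)
    ((Polynomial.aeval (1 : MvPolynomial σ k)).restrictScalars k) p
  simpa [esymmLine, Polynomial.coe_aeval_eq_eval] using h

theorem derives_coeffsUpTo_esymmLine (a : Fin n → k) (w : Fin n → MvPolynomial σ k) :
    Derives (Set.range w) (⋃ j, coeffsUpTo d (esymmLine a w j)) (n * ((d + 1) * 4)) := by
  have hcoeff (j : Fin n) (i : ℕ) : Derives (Set.range w) {(esymmLine a w j).coeff i} 4 := by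
    have hconst := Derives.C (Set.range w) (esymmTuple a j)
    match i with
    | 0 => simpa [esymmLine] using hconst.mono_cost (by lia)
    | 1 =>
      have hdiff := hconst.trans_of_union (Derives.linearCombination₂ 1 (-1)
        (Or.inl (Set.mem_range_self j)) (Or.inr rfl))
      simpa [esymmLine, Polynomial.coeff_C, sub_eq_add_neg] using hdiff
    | i + 2 =>
      simpa [esymmLine, Polynomial.coeff_C] using
        (Derives.C (Set.range w) 0).mono_cost (by lia : 1 ≤ 4)
  simpa using Derives.iUnion fun j => Derives.coeffsUpTo_of_coeff fun i (_ : i ≤ d) => hcoeff j i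

theorem aeval_eq_sum_coeff_aeval_newtonRoot {a : Fin n → k}
    (ha : Pairwise fun i j => IsUnit (a i - a j)) (w : Fin n → MvPolynomial σ k)
    {p : MvPolynomial (Fin n) k} (hp : p.totalDegree ≤ d) :
    aeval w p = ∑ j ∈ Finset.range (d + 1),
      (aeval (fun i => aeval (esymmLine a w) (newtonRoot a i d))
        (aeval (fun i : Fin n => esymm (Fin n) k (i + 1)) p)).coeff j := by
  have hdeg : (aeval (esymmLine a w) p).natDegree < d + 1 := by
    rw [← aeval_map_algebraMap (MvPolynomial σ k)]
    have hp' : (map (algebraMap k (MvPolynomial σ k)) p).totalDegree ≤ d :=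
      (Finset.sup_mono (support_map_subset _ p)).trans hp
    simpa [Nat.lt_succ_iff] using aeval_natDegree_le _ hp' _ (natDegree_esymmLine_le a w)
  have hline (j : Fin n) : Polynomial.X ∣ esymmLine a w j -
      algebraMap k (Polynomial (MvPolynomial σ k)) (esymmTuple a j) :=
    ⟨Polynomial.C (w j - C (esymmTuple a j)), add_sub_cancel_left _ _⟩
  have hdvd := dvd_aeval_newtonRoot_sub ha hline d p
  rw [← eval_one_aeval_esymmLine a, Polynomial.eval_eq_sum_range' hdeg]
  refine Finset.sum_congr rfl fun j hj => ?_
  have hcoeff := Polynomial.X_pow_dvd_iff.1 hdvd j (Finset.mem_range.1 hj)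
  rw [one_pow, mul_one, ← sub_eq_zero, ← neg_sub, ← Polynomial.coeff_sub, hcoeff, neg_zero]

theorem derives_aeval {a : Fin n → k} (ha : Pairwise fun i j => IsUnit (a i - a j))
    (w : Fin n → MvPolynomial σ k) {p : MvPolynomial (Fin n) k} (hp : p.totalDegree ≤ d) :
    Derives (Set.range w) {aeval w p} (n * ((d + 1) * 4) +
      5 * (d + 1) ^ 2 * (8 * (n + 1) ^ 3 * (d + 1)) +
      5 * (d + 1) ^ 2 * circuitSize (aeval (fun i : Fin n => esymm (Fin n) k (i + 1)) p) +
      (d + 2)) := by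
  set f := aeval (fun i : Fin n => esymm (Fin n) k (i + 1)) p
  let root i := aeval (esymmLine a w) (newtonRoot a i d)
  have hroots : Derives (⋃ j, coeffsUpTo d (esymmLine a w j)) (⋃ i, coeffsUpTo d (root i)) _ :=
    (Derives.coeffsUpTo_aeval_of_derives (derives_newtonRoot a d)
      (Set.subset_iUnion fun j => coeffsUpTo d (esymmLine a w j))).mono_target
        (by rw [Set.biUnion_range])
  have hf := Derives.coeffsUpTo_aeval (Set.subset_iUnion fun i => coeffsUpTo d (root i)) f
  have hsum := Derives.finset_sum (s := Finset.range (d + 1)) (fun _ => (1 : k)) fun j hj =>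
    coeff_mem_coeffsUpTo (aeval root f) (Nat.lt_succ_iff.1 (Finset.mem_range.1 hj))
  rw [aeval_eq_sum_coeff_aeval_newtonRoot ha w hp]
  simpa only [map_one, one_mul, Finset.card_range, add_comm 1 (d + 1)] using
    (((derives_coeffsUpTo_esymmLine a w).trans hroots).trans hf).trans hsum

theorem circuitSize_aeval_le {a : Fin n → k} (ha : Pairwise fun i j => IsUnit (a i - a j))
    {w : Fin n → MvPolynomial σ k} (hw : Derives ∅ (Set.range w) c)
    (p : MvPolynomial (Fin n) k) :
    circuitSize (aeval w p) ≤ 20 * p.totalDegree ^ 2 *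
      circuitSize (aeval (fun i : Fin n => esymm (Fin n) k (i + 1)) p) +
        (c + 46 * (n + p.totalDegree + 1) ^ 6) := by
  generalize hd : p.totalDegree = d
  obtain rfl | hpos := d.eq_zero_or_pos
  · rw [totalDegree_eq_zero_iff_eq_C.1 hd, aeval_C]
    have := (Derives.C ∅ (coeff 0 p) : Derives (σ := σ) _ _ _).circuitSize_le
    have := Nat.one_le_pow 6 (n + 0 + 1) (by lia)
    rw [algebraMap_eq]
    lia
  refine (hw.trans (derives_aeval ha w hd.le)).circuitSize_le.trans ?_
  generalize circuitSize (aeval (fun i : Fin n => esymm (Fin n) k (i + 1)) p) = s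
  set N := n + d + 1
  have hN : 1 ≤ N := by lia
  have hline : n * ((d + 1) * 4) ≤ 4 * N ^ 6 := calc
    _ ≤ N * (N * 4) := by gcongr <;> lia
    _ = 4 * N ^ 2 := by ring
    _ ≤ 4 * N ^ 6 := by gcongr; lia
  have hroots : 5 * (d + 1) ^ 2 * (8 * (n + 1) ^ 3 * (d + 1)) ≤ 40 * N ^ 6 := calc
    _ ≤ 5 * N ^ 2 * (8 * N ^ 3 * N) := by gcongr <;> lia
    _ = 40 * N ^ 6 := by ring
  have hf : 5 * (d + 1) ^ 2 * s ≤ 20 * d ^ 2 * s := Nat.mul_le_mul_right s (by nlinarith)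
  have hsum : d + 2 ≤ 2 * N ^ 6 := by
    have := Nat.le_self_pow (n := 6) (by lia) N
    lia
  linarith

theorem pairwise_isUnit_natCast_sub (R : Type*) [CommRing R] [Algebra ℚ R] (n : ℕ) :
    Pairwise fun i j : Fin n => IsUnit ((i : R) - (j : R)) := by
  intro i j hij
  have hne : ((i : ℚ) - (j : ℚ)) ≠ 0 := sub_ne_zero.2 (by simpa [Fin.val_inj] using hij)
  simpa using hne.isUnit.map (algebraMap ℚ R)

theorem circuitSize_aeval_le_of_algebra_rat [Algebra ℚ k] {w : Fin n → MvPolynomial σ k}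
    (hw : Derives ∅ (Set.range w) (5 * (n + 1) ^ 2)) (p : MvPolynomial (Fin n) k) :
    circuitSize (aeval w p) ≤ 20 * p.totalDegree ^ 2 *
      circuitSize (aeval (fun i : Fin n => esymm (Fin n) k (i + 1)) p) +
        51 * (n + p.totalDegree + 1) ^ 51 := by
  refine (circuitSize_aeval_le (pairwise_isUnit_natCast_sub k n) hw p).trans ?_
  gcongr
  set N := n + p.totalDegree + 1
  have hN : 1 ≤ N := by lia
  calc
    5 * (n + 1) ^ 2 + 46 * N ^ 6 ≤ 5 * N ^ 2 + 46 * N ^ 6 := by gcongr; lia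
    _ ≤ 5 * N ^ 51 + 46 * N ^ 51 := by gcongr <;> lia
    _ = 51 * N ^ 51 := by rw [← add_mul]

end Cost

open MvPolynomial in
theorem theorem4p13_general :
    ∃ K c : ℕ, ∀ (R : Type*) [CommRing R] [Algebra ℚ R] (n : ℕ) (f : MvPolynomial (Fin n) R),
      f.IsSymmetric → ∃ fE fH fP : MvPolynomial (Fin n) R,
        (∀ g, f = aeval (fun i : Fin n => esymm (Fin n) R (i + 1)) g ↔ g = fE) ∧
        (∀ g, f = aeval (fun i : Fin n => hsymm (Fin n) R (i + 1)) g ↔ g = fH) ∧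
        (∀ g, f = aeval (fun i : Fin n => psum (Fin n) R (i + 1)) g ↔ g = fP) ∧
        circuitSize fE ≤
          K * fE.totalDegree ^ 2 * circuitSize f + c * (n + fE.totalDegree + 1) ^ c ∧
        circuitSize fH ≤
          K * fE.totalDegree ^ 2 * circuitSize f + c * (n + fE.totalDegree + 1) ^ c ∧
        circuitSize fP ≤
          K * fE.totalDegree ^ 2 * circuitSize f + c * (n + fE.totalDegree + 1) ^ c := by
  refine ⟨20, 51, fun R _ _ n f hf => ?_⟩
  obtain ⟨p, rfl⟩ := exists_aeval_esymm_eq hf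
  have hX : Derives ∅ (Set.range (X : Fin n → MvPolynomial (Fin n) R)) (5 * (n + 1) ^ 2) :=
    (Derives.range_X ∅).mono_cost (by rw [Fintype.card_fin]; nlinarith)
  refine ⟨p, _, _, fun g => (aeval_esymm_injective n).eq_iff.trans eq_comm,
    aeval_esymm_eq_aeval_hsymm_iff p, aeval_esymm_eq_aeval_psum_iff p, ?_,
    circuitSize_aeval_le_of_algebra_rat (derives_newtonRec _) p,
    circuitSize_aeval_le_of_algebra_rat (derives_newtonRec _) p⟩
  simpa only [aeval_X_left_apply] using circuitSize_aeval_le_of_algebra_rat hX p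

theorem theorem4p13 :
    ∃ K c : ℕ, ∀ (n : ℕ) (f : MvPolynomial (Fin n) ℂ), f.IsSymmetric →
      ∃ fE fH fP : MvPolynomial (Fin n) ℂ,
        (∀ g : MvPolynomial (Fin n) ℂ,
          f = MvPolynomial.aeval
            (fun i : Fin n => MvPolynomial.esymm (Fin n) ℂ ((i : ℕ) + 1)) g ↔ g = fE) ∧
        (∀ g : MvPolynomial (Fin n) ℂ,
          f = MvPolynomial.aeval
            (fun i : Fin n => MvPolynomial.hsymm (Fin n) ℂ ((i : ℕ) + 1)) g ↔ g = fH) ∧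
        (∀ g : MvPolynomial (Fin n) ℂ,
          f = MvPolynomial.aeval
            (fun i : Fin n => MvPolynomial.psum (Fin n) ℂ ((i : ℕ) + 1)) g ↔ g = fP) ∧
        circuitSize fE ≤
          K * fE.totalDegree ^ 2 * circuitSize f + c * (n + fE.totalDegree + 1) ^ c ∧
        circuitSize fH ≤
          K * fE.totalDegree ^ 2 * circuitSize f + c * (n + fE.totalDegree + 1) ^ c ∧
        circuitSize fP ≤
          K * fE.totalDegree ^ 2 * circuitSize f + c * (n + fE.totalDegree + 1) ^ c := by
  obtain ⟨K, c, h⟩ := theorem4p13_general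
  exact ⟨K, c, h ℂ⟩
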